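/- **Setting.** A *manifold* $\mathcal M$ is a complete (finite-dimensional, smooth, boundaryless) Riemannian manifold whose Riemannian distance $d:\mathcal M\times\mathcal M\to[0,\infty)$ is finite. Geodesics are the curves of zero covariant acceleration for the Levi-Civita connection; a length-minimizing geodesic from $a$ to $b$ is a geodesic from $a$ to $b$ of length $d(a,b)$, and uniqueness is understood up to parametrization. A signal is a finite sequence $u=(u_i)_{i=0}^n$ in $\mathcal M$, $n\ge 0$. It is *geodesic* if there are $L\ge 0$ and a unit speed geodesic $\gamma:[0,L]\to\mathcal M$ (a point if $L=0$) with $\gamma(iL/n)=u_i$ for $0\le i\le n$ and $d(u_i,u_{i+1})=L/n$ for $0\le i\le n-1$ (a one-point signal is always geodesic), and *locally geodesic* if $(u_{i-1},u_i,u_{i+1})$ is geodesic for every $1\le i\le n-1$. Let $\alpha_0,\alpha_1>0$. Let $D$ be a distance-type function, i.e. for each manifold $\mathcal M$ a function $D:\mathcal M^2\times\mathcal M^2\to[0,\infty)$; write $[x,y]\in\mathcal M^2$. For a signal $u$ let $$\text{M-TGV}^2_\alpha(u)=\min_{y_0,\dots,y_{n-1}\in\mathcal M} E_u(y),\qquad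 E_u(y)=\sum_{i=0}^{n-1}\alpha_1 d(u_{i+1},y_i)+\sum_{i=1}^{n-1}\alpha_0 D([u_i,y_i],[u_{i-1},y_{i-1}]).$$ For a general $D$ the minimum need not be attained; $\text{M-TGV}^2_\alpha(u)$ then denotes the infimum. Put $\mathrm{TV}(u)=\sum_{i=0}^{n-1} d(u_{i+1},u_i)$, and for signals $u$ in $\mathbb R^K$ put $$\mathrm{TGV}^2_\alpha(u)=\min_{w_0,\dots,w_{n-1}\in\mathbb R^K}\ \sum_{i=0}^{n-1}\alpha_1|u_{i+1}-u_i-w_i|+\sum_{i=1}^{n-1}\alpha_0|w_i-w_{i-1}|,\qquad \mathrm{TV}^2(u)=\sum_{i=1}^{n-1}|u_{i-1}-2u_i+u_{i+1}|.$$ **Proposition.** Assume that * $D([x,x],[u,u])=0$ for all $x,u\in\mathcal M$ and all $\mathcal M$; * $D([x,y],[u,v])=|(y-x)-(v-u)|$ in case $\mathcal M=\mathbb R^K$. Then the following hold. * **(M-P1)** If $\mathcal M=\mathbb R^K$, then $\text{M-TGV}^2_\alpha(u)=\mathrm{TGV}^2_\alpha(u)$ for all signals $u$, both minima being attained. * **(M-P2)**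 If the minimum of $E_u$ is attained at $y_i=u_i$ $(0\le i\le n-1)$, then $\text{M-TGV}^2_\alpha(u)=\alpha_1\mathrm{TV}(u)$. * **(M-P3)** If the minimum of $E_u$ is attained at $y_i=u_{i+1}$ $(0\le i\le n-1)$, then $\text{M-TGV}^2_\alpha(u)=\alpha_0\mathrm{TV}^2_D(u)$, where $\mathrm{TV}^2_D(u)=\sum_{i=1}^{n-1}D([u_i,u_{i+1}],[u_{i-1},u_i])$ is an admissible generalization of $\mathrm{TV}^2$, i.e. $\mathrm{TV}^2_D=\mathrm{TV}^2$ in case $\mathcal M=\mathbb R^K$. Let $\mathcal M$ be any manifold. * If $D([v_1,v_2],[v_0,v_1])=0$ for every geodesic three-point signal $(v_0,v_1,v_2)$ in $\mathcal M$, then $\text{M-TGV}^2_\alpha(u)=0$, with the minimum attained, for every locally geodesic signal $u$ in $\mathcal M$. * Conversely, assume that for every three-point signal $(v_0,v_1,v_2)$ in $\mathcal M$ such that the length-minimizing geodesic connecting $v_i$ and $v_{i'}$ is unique whenever $|i-i'|\le1$, $D([v_1,v_2],[v_0,v_1])=0$ implies that $(v_0,v_1,v_2)$ is geodesic. Then,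 for every signal $u$ in $\mathcal M$ such that the length-minimizing geodesic connecting $u_i$ and $u_{i'}$ is unique whenever $|i-i'|\le1$ and such that the minimum of $E_u$ is attained, $\text{M-TGV}^2_\alpha(u)=0$ implies that $u$ is geodesic. -/

import Mathlib

open Set Bundle
open scoped Manifold ContDiff NNReal

noncomputable section

namespace MTGV

attribute [local instance 10000] chartedSpaceSelf

/-! ### Complete Riemannian manifolds and their geodesics -/

/-- A complete smooth Riemannian manifold without boundary, of finite dimension `dim`, equipped with
the (finite) distance induced by its Riemannian metric. -/
structure RiemannianMfd : Type 1 where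
  dim : ℕ
  carrier : Type
  [metric : MetricSpace carrier]
  [complete : CompleteSpace carrier]
  [charted : ChartedSpace (EuclideanSpace ℝ (Fin dim)) carrier]
  [isManifold : IsManifold (𝓡 dim) ∞ carrier]
  [bundle : RiemannianBundle (fun x : carrier ↦ TangentSpace (𝓡 dim) x)]
  [smoothMetric : IsContMDiffRiemannianBundle (𝓡 dim) ∞ (EuclideanSpace ℝ (Fin dim))
    (fun x : carrier ↦ TangentSpace (𝓡 dim) x)]
  [riemannian : IsRiemannianManifold (𝓡 dim) carrier]

instance : CoeSort RiemannianMfd Type := ⟨RiemannianMfd.carrier⟩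

attribute [instance] RiemannianMfd.metric RiemannianMfd.complete RiemannianMfd.charted
  RiemannianMfd.isManifold RiemannianMfd.bundle RiemannianMfd.smoothMetric
  RiemannianMfd.riemannian

/-- The vector space `ℝ^K` with its Euclidean structure, as a Riemannian manifold. -/
abbrev euclidean (K : ℕ) : RiemannianMfd where
  dim := K
  carrier := EuclideanSpace ℝ (Fin K)

section Geodesic

variable {m : ℕ} {M : Type} [MetricSpace M] [ChartedSpace (EuclideanSpace ℝ (Fin m)) M]
  [RiemannianBundle (fun x : M ↦ TangentSpace (𝓡 m) x)]

/-- The Riemannian metric in the preferred chart at `p`: the inner product, at the point with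
coordinates `z`, of the tangent vectors with coordinates `v` and `w`. -/
def chartMetric (p : M) (z v w : EuclideanSpace ℝ (Fin m)) : ℝ :=
  inner ℝ (mfderiv (𝓡 m) (𝓡 m) (extChartAt (𝓡 m) p).symm z v)
    (mfderiv (𝓡 m) (𝓡 m) (extChartAt (𝓡 m) p).symm z w)

/-- The Christoffel symbols of the first kind of the Levi-Civita connection, in the preferred chart
at `p`, i.e. `Γ_{ab,w} = (∂_a g_{bw} + ∂_b g_{aw} - ∂_w g_{ab}) / 2` as a trilinear form. -/
def christoffel (p : M) (z a b w : EuclideanSpace ℝ (Fin m)) : ℝ :=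
  (fderiv ℝ (fun z' ↦ chartMetric p z' b w) z a
    + fderiv ℝ (fun z' ↦ chartMetric p z' a w) z b
    - fderiv ℝ (fun z' ↦ chartMetric p z' a b) z w) / 2

variable (m) in
/-- The inner product of the covariant acceleration `(D/dt) (d/dt) γ` (taken with respect to the
Levi-Civita connection) at time `t` with the tangent vector at `γ t` that has coordinates `w` in the
preferred chart at `γ t`; with `c` the coordinate expression of `γ` in this chart, this is
`g(c'', w) + Γ_{c' c', w}`. -/
def covariantAcceleration (γ : ℝ → M) (t : ℝ) (w : EuclideanSpace ℝ (Fin m)) : ℝ :=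
  let c : ℝ → EuclideanSpace ℝ (Fin m) := fun s ↦ extChartAt (𝓡 m) (γ t) (γ s)
  chartMetric (γ t) (c t) (deriv (deriv c) t) w
    + christoffel (γ t) (c t) (deriv c t) (deriv c t) w

variable (m) in
/-- `γ` restricted to `[0, L]` is a geodesic parametrized with unit speed: it is smooth on `[0, L]`
and has unit speed and zero covariant acceleration on `(0, L)` (hence, by continuity, on `[0, L]`
if `0 < L`). The interval may degenerate to a point. -/
structure IsUnitSpeedGeodesic (γ : ℝ → M) (L : ℝ) : Prop where
  nonneg : 0 ≤ L
  smooth : ContMDiffOn 𝓘(ℝ, ℝ) (𝓡 m) ∞ γ (Icc 0 L)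
  unit_speed : ∀ t ∈ Ioo 0 L, ‖mfderiv 𝓘(ℝ, ℝ) (𝓡 m) γ t (1 : ℝ)‖ = 1
  acceleration_zero : ∀ t ∈ Ioo 0 L, ∀ w, covariantAcceleration m γ t w = 0

variable (m) in
/-- `γ` restricted to `[0, d(x, y)]` is a length-minimizing geodesic from `x` to `y`, parametrized
with unit speed (so that its length is `d(x, y)`). -/
def IsMinimizingGeodesic (γ : ℝ → M) (x y : M) : Prop :=
  IsUnitSpeedGeodesic m γ (dist x y) ∧ γ 0 = x ∧ γ (dist x y) = y

variable (m) in
/-- There is exactly one length-minimizing geodesic from `x` to `y`. -/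
def UniqueMinimizingGeodesic (x y : M) : Prop :=
  ∃ γ : ℝ → M, IsMinimizingGeodesic m γ x y ∧
    ∀ γ' : ℝ → M, IsMinimizingGeodesic m γ' x y → EqOn γ' γ (Icc 0 (dist x y))

variable (m) in
/-- The signal `u_0, …, u_n` is geodesic. -/
def IsGeodesicSignal {n : ℕ} (u : Fin (n + 1) → M) : Prop :=
  ∃ (L : ℝ) (γ : ℝ → M), IsUnitSpeedGeodesic m γ L ∧
    (∀ i : Fin (n + 1), γ (((i : ℕ) : ℝ) * L / n) = u i) ∧
    ∀ i : Fin n, dist (u i.castSucc) (u i.succ) = L / n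

variable (m) in
/-- The signal `u_0, …, u_n` is locally geodesic: all its sections `u_{i-1}, u_i, u_{i+1}`,
`1 ≤ i ≤ n - 1`, are geodesic (here `i = j + 1`). -/
def IsLocallyGeodesicSignal {n : ℕ} (u : Fin (n + 1) → M) : Prop :=
  ∀ (j : ℕ) (h : j + 2 < n + 1),
    IsGeodesicSignal m (n := 2) ![u ⟨j, by omega⟩, u ⟨j + 1, by omega⟩, u ⟨j + 2, h⟩]

variable (m) in
/-- Length-minimizing geodesics between `u_i` and `u_{i'}` with `|i - i'| ≤ 1` are unique. -/
def UniqueNeighborGeodesics {n : ℕ} (u : Fin (n + 1) → M) : Prop :=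
  ∀ i i' : Fin (n + 1), |((i : ℕ) : ℤ) - ((i' : ℕ) : ℤ)| ≤ 1 →
    UniqueMinimizingGeodesic m (u i) (u i')

end Geodesic

/-! ### The functionals on manifold-valued signals -/

/-- A distance-type function for tangent tuples: for each manifold `M`, a function
`D : M² × M² → [0, ∞)`. The tangent tuple `[x, y]` is the pair `(x, y)`. -/
abbrev DistanceTypeFunction : Type 1 :=
  ∀ M : RiemannianMfd, M × M → M × M → ℝ≥0

variable (D : DistanceTypeFunction) (α₀ α₁ : ℝ) {M : RiemannianMfd} {n : ℕ}

/-- The objective `∑ α₁ d(u_{i+1}, y_i) + α₀ D([u_i, y_i], [u_{i-1}, y_{i-1}])` in the definition of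
M-TGV, for `u = (u_0, …, u_n)` and `y = (y_0, …, y_{n-1})`; the terms in which an index is out of
bounds contribute zero, so `D` is summed over `1 ≤ i ≤ n - 1` (written `i + 1` below). -/
def energy (u : Fin (n + 1) → M) (y : Fin n → M) : ℝ :=
  ∑ i : Fin n, α₁ * dist (u i.succ) (y i)
    + ∑ i : Fin (n - 1), α₀ *
      (D M (u ⟨i + 1, by omega⟩, y ⟨i + 1, by omega⟩) (u ⟨i, by omega⟩, y ⟨i, by omega⟩) : ℝ)

/-- `M-TGV²_α(u)`, the infimum of the objective over all `y`. -/
def mtgv (u : Fin (n + 1) → M) : ℝ := ⨅ y : Fin n → M, energy D α₀ α₁ u y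

/-- The minimum in the definition of `M-TGV²_α(u)` is attained at `y`. -/
def MinAttainedAt (u : Fin (n + 1) → M) (y : Fin n → M) : Prop :=
  ∀ y' : Fin n → M, energy D α₀ α₁ u y ≤ energy D α₀ α₁ u y'

/-- `TV(u) = ∑ d(u_{i+1}, u_i)`. -/
def tv (u : Fin (n + 1) → M) : ℝ := ∑ i : Fin n, dist (u i.succ) (u i.castSucc)

/-- The second-order total variation induced by `D`, that is
`∑ D([u_i, u_{i+1}], [u_{i-1}, u_i])`. -/
def inducedTV2 (M : RiemannianMfd) (n : ℕ) (u : Fin (n + 1) → M) : ℝ :=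
  ∑ i : Fin (n - 1),
    (D M (u ⟨i + 1, by omega⟩, u ⟨i + 2, by omega⟩) (u ⟨i, by omega⟩, u ⟨i + 1, by omega⟩) : ℝ)

/-! ### The functionals on vector-valued signals -/

section VectorSpace

variable {K : ℕ}

/-- Forward differences `u_{i+1} - u_i` of `u_0, …, u_n`. -/
def forwardDiff (u : Fin (n + 1) → EuclideanSpace ℝ (Fin K)) :
    Fin n → EuclideanSpace ℝ (Fin K) :=
  fun i ↦ u i.succ - u i.castSucc

/-- Backward differences `w_i - w_{i-1}`, `1 ≤ i ≤ n - 1`, of `w_0, …, w_{n-1}`. -/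
def backwardDiff (w : Fin n → EuclideanSpace ℝ (Fin K)) :
    Fin (n - 1) → EuclideanSpace ℝ (Fin K) :=
  fun i ↦ w ⟨i + 1, by omega⟩ - w ⟨i, by omega⟩

/-- The one-norm `∑ |w_i|`, with `|·|` the Euclidean norm. -/
def oneNorm {k : ℕ} (w : Fin k → EuclideanSpace ℝ (Fin K)) : ℝ := ∑ i, ‖w i‖

/-- The objective in the minimum representation of the univariate discrete TGV. -/
def tgvEnergy (u : Fin (n + 1) → EuclideanSpace ℝ (Fin K))
    (w : Fin n → EuclideanSpace ℝ (Fin K)) : ℝ :=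
  α₁ * oneNorm (forwardDiff u - w) + α₀ * oneNorm (backwardDiff w)

/-- Univariate discrete second-order TGV of a vector-valued signal. -/
def tgv (u : Fin (n + 1) → EuclideanSpace ℝ (Fin K)) : ℝ :=
  ⨅ w : Fin n → EuclideanSpace ℝ (Fin K), tgvEnergy α₀ α₁ u w

/-- `TV²(u) = ∑ |u_{i-1} - 2 u_i + u_{i+1}|` for vector-valued signals. -/
def vectorTV2 (u : Fin (n + 1) → EuclideanSpace ℝ (Fin K)) : ℝ :=
  ∑ i : Fin (n - 1), ‖u ⟨i, by omega⟩ - (2 : ℝ) • u ⟨i + 1, by omega⟩ + u ⟨i + 2, by omega⟩‖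

end VectorSpace

/-- A functional on manifold-valued signals is an admissible generalization of `TV²` if it reduces
to `TV²` in the vector space setting. -/
def IsAdmissibleTV2 (T : ∀ (M : RiemannianMfd) (n : ℕ), (Fin (n + 1) → M) → ℝ) : Prop :=
  ∀ (K n : ℕ) (u : Fin (n + 1) → EuclideanSpace ℝ (Fin K)), T (euclidean K) n u = vectorTV2 u

/-! ### The properties -/

/-- In the vector space setting, M-TGV reduces to TGV (both minima being attained). -/
def PropertyMP1 : Prop :=
  ∀ (K n : ℕ) (u : Fin (n + 1) → EuclideanSpace ℝ (Fin K)),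
    (∃ y : Fin n → EuclideanSpace ℝ (Fin K), MinAttainedAt D α₀ α₁ (M := euclidean K) u y) ∧
    (∃ w, ∀ w', tgvEnergy α₀ α₁ u w ≤ tgvEnergy α₀ α₁ u w') ∧
    mtgv D α₀ α₁ (M := euclidean K) u = tgv α₀ α₁ u

/-- If the minimum is attained at `y_i = u_i`, then `M-TGV²_α(u) = α₁ TV(u)`. -/
def PropertyMP2 : Prop :=
  ∀ (M : RiemannianMfd) (n : ℕ) (u : Fin (n + 1) → M),
    MinAttainedAt D α₀ α₁ u (fun i ↦ u i.castSucc) → mtgv D α₀ α₁ u = α₁ * tv u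

/-- The functional induced by `D` is an admissible generalization of `TV²`, and if the minimum is
attained at `y_i = u_{i+1}`, then `M-TGV²_α(u)` is `α₀` times this generalization. -/
def PropertyMP3 : Prop :=
  IsAdmissibleTV2 (inducedTV2 D) ∧
  ∀ (M : RiemannianMfd) (n : ℕ) (u : Fin (n + 1) → M),
    MinAttainedAt D α₀ α₁ u (fun i ↦ u i.succ) → mtgv D α₀ α₁ u = α₀ * inducedTV2 D M n u

end MTGV

end

namespace MTGV

open Filter Topology

/-! ### Unit speed geodesics on arbitrary closed intervals -/

section Geodesic

variable {m : ℕ} {M : Type} [MetricSpace M] [ChartedSpace (EuclideanSpace ℝ (Fin m)) M]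
  [RiemannianBundle (fun x : M ↦ TangentSpace (𝓡 m) x)]

/-! Every term of the objective is nonnegative, and this settles the zero set. The objective
vanishes only at `y_i = u_{i+1}`, where it equals `α₀` times the induced `TV²`; this is zero exactly
when `D` vanishes on every consecutive triple. (M-P2) and (M-P3) evaluate the objective at the given
minimizer. For (M-P1), substituting `w_i = y_i - u_i` gives the TGV objective, which is continuous
and coercive.

The converse needs geometry: a locally geodesic signal with unique minimizing geodesics between
neighbors is geodesic. Consecutive triples share a pair of points, so all steps have one length `ℓ`,
and on the shared segment both geodesics are minimizing, hence equal by uniqueness. If `ℓ > 0`, they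
agree on an interval and not just at a point. Smoothness, unit speed and zero acceleration are
local, so they pass to the glued curve (`glue`, `exists_geodesic_of_triples`). -/

variable (m) in
/-- `γ` restricted to `[p, q]` is a geodesic parametrized with unit speed. -/
structure IsUnitSpeedGeodesicOn (γ : ℝ → M) (p q : ℝ) : Prop where
  smooth : ContMDiffOn 𝓘(ℝ, ℝ) (𝓡 m) ∞ γ (Icc p q)
  unit_speed : ∀ t ∈ Ioo p q, ‖mfderiv 𝓘(ℝ, ℝ) (𝓡 m) γ t (1 : ℝ)‖ = 1
  acceleration_zero : ∀ t ∈ Ioo p q, ∀ w, covariantAcceleration m γ t w = 0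

theorem speed_congr {γ γ' : ℝ → M} {t : ℝ} (h : γ =ᶠ[𝓝 t] γ') :
    ‖mfderiv 𝓘(ℝ, ℝ) (𝓡 m) γ t (1 : ℝ)‖ = ‖mfderiv 𝓘(ℝ, ℝ) (𝓡 m) γ' t (1 : ℝ)‖ := by
  -- The two norms live on different fibers; the equality of base points is eliminated with the
  -- vector held fixed in coordinates.
  have key : ∀ (x y : M) (_ : x = y) (v : EuclideanSpace ℝ (Fin m)),
      ‖(show TangentSpace (𝓡 m) x from v)‖ = ‖(show TangentSpace (𝓡 m) y from v)‖ := by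
    rintro x _ rfl v
    rfl
  have h' := h.mfderiv_eq (I := 𝓘(ℝ, ℝ)) (I' := 𝓡 m)
  have h1 := key (γ t) (γ' t) h.eq_of_nhds (mfderiv 𝓘(ℝ, ℝ) (𝓡 m) γ t (1 : ℝ))
  refine h1.trans ?_
  exact congrArg
    (fun A : ℝ →L[ℝ] EuclideanSpace ℝ (Fin m) ↦ ‖(show TangentSpace (𝓡 m) (γ' t) from A 1)‖) h'

theorem covariantAcceleration_congr {γ γ' : ℝ → M} {t : ℝ} (h : γ =ᶠ[𝓝 t] γ')
    (w : EuclideanSpace ℝ (Fin m)) :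
    covariantAcceleration m γ t w = covariantAcceleration m γ' t w := by
  have ht : γ t = γ' t := h.eq_of_nhds
  have hc : (fun s ↦ extChartAt (𝓡 m) (γ t) (γ s)) =ᶠ[𝓝 t]
      fun s ↦ extChartAt (𝓡 m) (γ' t) (γ' s) := by
    filter_upwards [h] with s hs
    rw [ht, hs]
  simp only [covariantAcceleration]
  rw [hc.deriv_eq, hc.deriv.deriv_eq, ht]

theorem speed_comp_sub {γ : ℝ → M} {t c : ℝ}
    (h : MDifferentiableAt 𝓘(ℝ, ℝ) (𝓡 m) γ (t - c)) :
    ‖mfderiv 𝓘(ℝ, ℝ) (𝓡 m) (fun s ↦ γ (s - c)) t (1 : ℝ)‖ =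
      ‖mfderiv 𝓘(ℝ, ℝ) (𝓡 m) γ (t - c) (1 : ℝ)‖ := by
  have hs : HasMFDerivAt 𝓘(ℝ, ℝ) 𝓘(ℝ, ℝ) (fun s : ℝ ↦ s - c) t (ContinuousLinearMap.id ℝ ℝ) :=
    ((hasFDerivAt_id t).sub_const c).hasMFDerivAt
  have hd := HasMFDerivAt.comp t h.hasMFDerivAt hs
  have he : mfderiv 𝓘(ℝ, ℝ) (𝓡 m) (fun s ↦ γ (s - c)) t =
      (mfderiv 𝓘(ℝ, ℝ) (𝓡 m) γ (t - c)).comp (ContinuousLinearMap.id ℝ ℝ) := hd.mfderiv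
  rw [he]
  rfl

theorem covariantAcceleration_comp_sub (γ : ℝ → M) (t c : ℝ) (w : EuclideanSpace ℝ (Fin m)) :
    covariantAcceleration m (fun s ↦ γ (s - c)) t w = covariantAcceleration m γ (t - c) w := by
  have h1 : deriv (fun s ↦ extChartAt (𝓡 m) (γ (t - c)) (γ (s - c))) =
      fun s ↦ deriv (fun r ↦ extChartAt (𝓡 m) (γ (t - c)) (γ r)) (s - c) := by
    funext s
    exact deriv_comp_sub_const (f := fun r ↦ extChartAt (𝓡 m) (γ (t - c)) (γ r)) ..
  simp only [covariantAcceleration]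
  rw [h1, deriv_comp_sub_const]

theorem isUnitSpeedGeodesic_iff {γ : ℝ → M} {L : ℝ} :
    IsUnitSpeedGeodesic m γ L ↔ 0 ≤ L ∧ IsUnitSpeedGeodesicOn m γ 0 L :=
  ⟨fun h ↦ ⟨h.1, h.2, h.3, h.4⟩, fun h ↦ ⟨h.1, h.2.1, h.2.2, h.2.3⟩⟩

/-- The speed and acceleration conditions range over the empty interval `Ioo 0 0`. -/
theorem isUnitSpeedGeodesic_const (x : M) : IsUnitSpeedGeodesic m (fun _ ↦ x) 0 :=
  ⟨le_rfl, contMDiffOn_const, by simp, by simp⟩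

namespace IsUnitSpeedGeodesicOn

theorem mono {γ : ℝ → M} {p q p' q' : ℝ} (h : IsUnitSpeedGeodesicOn m γ p q)
    (hp : p ≤ p') (hq : q' ≤ q) : IsUnitSpeedGeodesicOn m γ p' q' :=
  ⟨h.smooth.mono (Icc_subset_Icc hp hq), fun t ht ↦ h.unit_speed t (Ioo_subset_Ioo hp hq ht),
    fun t ht ↦ h.acceleration_zero t (Ioo_subset_Ioo hp hq ht)⟩

theorem comp_sub {γ : ℝ → M} {p q : ℝ} (h : IsUnitSpeedGeodesicOn m γ p q) (c : ℝ) :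
    IsUnitSpeedGeodesicOn m (fun s ↦ γ (s - c)) (p + c) (q + c) := by
  have hI : ∀ t ∈ Ioo (p + c) (q + c), t - c ∈ Ioo p q := fun t ht ↦
    ⟨by linarith [ht.1], by linarith [ht.2]⟩
  refine ⟨?_, fun t ht ↦ ?_, fun t ht w ↦ ?_⟩
  · have hs : ContMDiff 𝓘(ℝ, ℝ) 𝓘(ℝ, ℝ) ∞ (fun s : ℝ ↦ s - c) :=
      (contDiff_id.sub contDiff_const).contMDiff
    exact h.smooth.comp hs.contMDiffOn fun t ht ↦ ⟨by linarith [ht.1], by linarith [ht.2]⟩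
  · rw [speed_comp_sub, h.unit_speed _ (hI t ht)]
    exact ((h.smooth.contMDiffAt (Icc_mem_nhds (hI t ht).1 (hI t ht).2)).mdifferentiableAt
      (by simp))
  · rw [covariantAcceleration_comp_sub, h.acceleration_zero _ (hI t ht)]

/-- Two unit speed geodesics that agree on an overlap of positive length glue together. -/
theorem glue {f g : ℝ → M} {p q r s : ℝ} (hf : IsUnitSpeedGeodesicOn m f p q)
    (hg : IsUnitSpeedGeodesicOn m g r s) (hrq : r < q) (hfg : EqOn f g (Icc r q)) :
    IsUnitSpeedGeodesicOn m (fun t ↦ if t ≤ q then f t else g t) p s := by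
  set F : ℝ → M := fun t ↦ if t ≤ q then f t else g t with hF
  -- As `r < q`, the open half-lines `Iio q` and `Ioi r` cover the line, so near every point `F`
  -- coincides with `f` or with `g`.
  have hFf : EqOn F f (Iio q) := fun t ht ↦ if_pos (le_of_lt ht)
  have hFg : EqOn F g (Ioi r) := fun t ht ↦ by
    by_cases h : t ≤ q
    · simp only [hF, if_pos h]
      exact hfg ⟨le_of_lt ht, h⟩
    · simp only [hF, if_neg h]
  have hnf : ∀ {t}, t < q → F =ᶠ[𝓝 t] f := fun ht ↦ hFf.eventuallyEq_of_mem (Iio_mem_nhds ht)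
  have hng : ∀ {t}, r < t → F =ᶠ[𝓝 t] g := fun ht ↦ hFg.eventuallyEq_of_mem (Ioi_mem_nhds ht)
  refine ⟨fun t ht ↦ ?_, fun t ht ↦ ?_, fun t ht w ↦ ?_⟩ <;> rcases lt_or_ge t q with h | h
  · have h1 : ContMDiffWithinAt 𝓘(ℝ, ℝ) (𝓡 m) ∞ f (Icc p s) t :=
      (hf.smooth t ⟨ht.1, h.le⟩).mono_of_mem_nhdsWithin
        (mem_nhdsWithin.2 ⟨Iio q, isOpen_Iio, h, fun x hx ↦ ⟨hx.2.1, le_of_lt hx.1⟩⟩)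
    exact h1.congr_of_eventuallyEq ((hnf h).filter_mono nhdsWithin_le_nhds) (hFf h)
  · have h' : r < t := hrq.trans_le h
    have h1 : ContMDiffWithinAt 𝓘(ℝ, ℝ) (𝓡 m) ∞ g (Icc p s) t :=
      (hg.smooth t ⟨h'.le, ht.2⟩).mono_of_mem_nhdsWithin
        (mem_nhdsWithin.2 ⟨Ioi r, isOpen_Ioi, h', fun x hx ↦ ⟨le_of_lt hx.1, hx.2.2⟩⟩)
    exact h1.congr_of_eventuallyEq ((hng h').filter_mono nhdsWithin_le_nhds) (hFg h')
  · rw [speed_congr (hnf h), hf.unit_speed t ⟨ht.1, h⟩]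
  · rw [speed_congr (hng (hrq.trans_le h)), hg.unit_speed t ⟨hrq.trans_le h, ht.2⟩]
  · rw [covariantAcceleration_congr (hnf h), hf.acceleration_zero t ⟨ht.1, h⟩]
  · rw [covariantAcceleration_congr (hng (hrq.trans_le h)),
      hg.acceleration_zero t ⟨hrq.trans_le h, ht.2⟩]

/-- Shifts a segment of a longer curve to start at time 0, the form to which uniqueness of
minimizing geodesics applies. -/
theorem isMinimizingGeodesic {γ : ℝ → M} {p q : ℝ} (h : IsUnitSpeedGeodesicOn m γ p q)
    (hd : dist (γ p) (γ q) = q - p) :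
    IsMinimizingGeodesic m (fun t ↦ γ (t + p)) (γ p) (γ q) := by
  have h1 := h.comp_sub (-p)
  simp only [sub_neg_eq_add, add_neg_cancel, ← sub_eq_add_neg] at h1
  refine ⟨isUnitSpeedGeodesic_iff.2 ⟨dist_nonneg, ?_⟩, by simp, by simp [hd]⟩
  rwa [hd]

end IsUnitSpeedGeodesicOn

theorem UniqueMinimizingGeodesic.eqOn {x y : M} (h : UniqueMinimizingGeodesic m x y)
    {γ γ' : ℝ → M} (h₁ : IsMinimizingGeodesic m γ x y) (h₂ : IsMinimizingGeodesic m γ' x y) :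
    EqOn γ γ' (Icc 0 (dist x y)) := by
  obtain ⟨γ₀, -, h⟩ := h
  exact (h _ h₁).trans (h _ h₂).symm

/-- A chain of unit speed geodesics through consecutive triples of equidistant points glues to a
single geodesic, if the minimizing geodesics between neighbors are unique. -/
theorem exists_geodesic_of_triples (u : ℕ → M) (N : ℕ) (ℓ : ℝ) (hℓ : 0 < ℓ)
    (hdist : ∀ k ≤ N, dist (u k) (u (k + 1)) = ℓ)
    (huniq : ∀ k ≤ N, UniqueMinimizingGeodesic m (u k) (u (k + 1)))
    (htriple : ∀ k < N, ∃ γ : ℝ → M, IsUnitSpeedGeodesicOn m γ 0 (2 * ℓ) ∧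
      γ 0 = u k ∧ γ ℓ = u (k + 1) ∧ γ (2 * ℓ) = u (k + 2)) :
    ∃ γ : ℝ → M, IsUnitSpeedGeodesicOn m γ 0 ((N + 1 : ℕ) * ℓ) ∧
      ∀ i ≤ N + 1, γ (i * ℓ) = u i := by
  induction N with
  | zero =>
    obtain ⟨γ, ⟨hγ, h0, h1⟩, -⟩ := huniq 0 le_rfl
    rw [hdist 0 le_rfl] at hγ h1
    refine ⟨γ, by simpa using (isUnitSpeedGeodesic_iff.1 hγ).2, fun i hi ↦ ?_⟩
    interval_cases i <;> simpa
  | succ N ih =>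
    obtain ⟨f, hf, hfu⟩ := ih (fun k hk ↦ hdist k (by omega)) (fun k hk ↦ huniq k (by omega))
      (fun k hk ↦ htriple k (by omega))
    obtain ⟨g, hg, hg0, hg1, hg2⟩ := htriple N (by omega)
    have hNℓ : 0 ≤ (N : ℝ) * ℓ := by positivity
    have hd := hdist N (by omega)
    have hfN := hfu N (by omega)
    have hfN1 := hfu (N + 1) le_rfl
    -- The last segment of `f` and the first half of `g` both minimize between `u N` and `u (N +
    -- 1)`, so uniqueness identifies them.
    have hff := (hf.mono hNℓ le_rfl).isMinimizingGeodesic (by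
      rw [hfN, hfN1, hd]
      push_cast
      ring)
    have hgg := (hg.mono le_rfl (by linarith : ℓ ≤ 2 * ℓ)).isMinimizingGeodesic (by
      rw [hg0, hg1, hd, sub_zero])
    rw [hfN, hfN1] at hff
    rw [hg0, hg1] at hgg
    have heq := (huniq N (by omega)).eqOn hff hgg
    rw [hd] at heq
    have hlt : (N : ℝ) * ℓ < (N + 1 : ℕ) * ℓ := by
      push_cast
      linarith
    have hfg : EqOn f (fun t ↦ g (t - N * ℓ)) (Icc (N * ℓ) ((N + 1 : ℕ) * ℓ)) := by
      intro t ht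
      have := @heq (t - N * ℓ) ⟨by linarith [ht.1], by
        have := ht.2
        push_cast at this
        linarith⟩
      simpa using this
    have hg' := hg.comp_sub (N * ℓ)
    rw [zero_add] at hg'
    have hend : 2 * ℓ + N * ℓ = ((N + 1 + 1 : ℕ) : ℝ) * ℓ := by
      push_cast
      ring
    rw [hend] at hg'
    refine ⟨_, hf.glue hg' hlt hfg, fun i hi ↦ ?_⟩
    rcases Nat.lt_or_ge (N + 1) i with h | h
    · obtain rfl : i = N + 1 + 1 := by omega
      have : ¬ (((N + 1 + 1 : ℕ) : ℝ) * ℓ ≤ (N + 1 : ℕ) * ℓ) := by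
        push_cast
        linarith
      simp only [if_neg this]
      rw [← hend, add_sub_cancel_right, hg2]
    · have : (i : ℝ) * ℓ ≤ (N + 1 : ℕ) * ℓ :=
        mul_le_mul_of_nonneg_right (by exact_mod_cast h) hℓ.le
      simp only [if_pos this]
      exact hfu i h

theorem IsGeodesicSignal.of_length_zero {n : ℕ} {u : Fin (n + 1) → M} (h : ∀ i, u i = u 0) :
    IsGeodesicSignal m u :=
  ⟨0, fun _ ↦ u 0, isUnitSpeedGeodesic_const _, fun i ↦ (h i).symm, fun i ↦ by
    rw [h i.castSucc, h i.succ, dist_self, zero_div]⟩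

/-- A geodesic triple consists of equidistant points on a unit speed geodesic. -/
theorem IsGeodesicSignal.exists_of_triple {a b c : M}
    (h : IsGeodesicSignal m (n := 2) ![a, b, c]) :
    dist a b = dist b c ∧ ∃ γ : ℝ → M, IsUnitSpeedGeodesicOn m γ 0 (2 * dist a b) ∧
      γ 0 = a ∧ γ (dist a b) = b ∧ γ (2 * dist a b) = c := by
  obtain ⟨L, γ, hγ, hu, hd⟩ := h
  have h0 := hd 0
  have h1 := hd 1
  have e0 := hu 0
  have e1 := hu 1
  have e2 := hu 2
  simp at h0 h1 e0 e1 e2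
  have hL : L = 2 * dist a b := by linarith
  refine ⟨h0.trans h1.symm, γ, hL ▸ (isUnitSpeedGeodesic_iff.1 hγ).2, e0, ?_, ?_⟩
  · rw [h0, e1]
  · rw [← hL, e2]

/-- Locally geodesic signals are geodesic, if the minimizing geodesics between neighbors are
unique. -/
theorem IsLocallyGeodesicSignal.isGeodesicSignal {n : ℕ} {u : Fin (n + 1) → M}
    (h : IsLocallyGeodesicSignal m u) (huniq : UniqueNeighborGeodesics m u) :
    IsGeodesicSignal m u := by
  rcases n with _ | N
  · exact .of_length_zero fun i ↦ by rw [Fin.eq_zero i]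
  -- The default value `u 0` is never used: only indices up to `N + 1` occur below.
  set v : ℕ → M := fun k ↦ if hk : k < N + 1 + 1 then u ⟨k, hk⟩ else u 0 with hv
  have hvu : ∀ (k : ℕ) (hk : k < N + 1 + 1), v k = u ⟨k, hk⟩ := fun k hk ↦ dif_pos hk
  have hv3 : ∀ k < N, IsGeodesicSignal m (n := 2) ![v k, v (k + 1), v (k + 2)] := fun k hk ↦ by
    rw [hvu k (by omega), hvu (k + 1) (by omega), hvu (k + 2) (by omega)]
    exact h k (by omega)
  have hdist : ∀ k ≤ N, dist (v k) (v (k + 1)) = dist (v 0) (v 1) := by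
    intro k hk
    induction k with
    | zero => rfl
    | succ k ih => rw [← ih (by omega), (hv3 k (by omega)).exists_of_triple.1]
  -- Step length zero is treated apart, since gluing needs an overlap of positive length; the signal
  -- is then constant.
  rcases (dist_nonneg (x := v 0) (y := v 1)).eq_or_lt with h0 | hpos
  · have hv0 : ∀ k ≤ N + 1, v k = v 0 := by
      intro k hk
      induction k with
      | zero => rfl
      | succ k ih =>
        rw [← ih (by omega)]
        exact (dist_eq_zero.1 ((hdist k (by omega)).trans h0.symm)).symm
    refine .of_length_zero fun i ↦ ?_
    have := hv0 i (by omega)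
    rwa [hvu i i.2, hvu 0 (by omega)] at this
  · obtain ⟨γ, hγ, hγu⟩ := exists_geodesic_of_triples (m := m) v N _ hpos hdist
      (fun k hk ↦ by
        rw [hvu k (by omega), hvu (k + 1) (by omega)]
        exact huniq _ _ (by simp))
      (fun k hk ↦ by
        have := (hv3 k hk).exists_of_triple.2
        rwa [hdist k hk.le] at this)
    have hN : ((N + 1 : ℕ) : ℝ) ≠ 0 := by positivity
    refine ⟨(N + 1 : ℕ) * dist (v 0) (v 1), γ,
      isUnitSpeedGeodesic_iff.2 ⟨by positivity, hγ⟩, fun i ↦ ?_, fun i ↦ ?_⟩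
    · rw [mul_div_assoc, mul_div_cancel_left₀ _ hN, hγu i (by omega), hvu i i.2]
    · rw [mul_div_cancel_left₀ _ hN, ← hdist i (by omega), hvu i (by omega),
        hvu (i + 1) (by omega)]
      rfl

end Geodesic

/-! ### The objective and its minimum -/

section Energy

variable {D : DistanceTypeFunction} {α₀ α₁ : ℝ} {M : RiemannianMfd} {n : ℕ}

theorem MinAttainedAt.mtgv_eq {u : Fin (n + 1) → M} {y : Fin n → M}
    (h : MinAttainedAt D α₀ α₁ u y) : mtgv D α₀ α₁ u = energy D α₀ α₁ u y :=
  have : Nonempty (Fin n → M) := ⟨y⟩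
  le_antisymm (ciInf_le ⟨energy D α₀ α₁ u y, by rintro _ ⟨y', rfl⟩; exact h y'⟩ y) (le_ciInf h)

theorem energy_nonneg (hα₀ : 0 ≤ α₀) (hα₁ : 0 ≤ α₁) (u : Fin (n + 1) → M) (y : Fin n → M) :
    0 ≤ energy D α₀ α₁ u y :=
  add_nonneg (Finset.sum_nonneg fun _ _ ↦ mul_nonneg hα₁ dist_nonneg)
    (Finset.sum_nonneg fun _ _ ↦ mul_nonneg hα₀ (NNReal.coe_nonneg _))

theorem energy_succ (u : Fin (n + 1) → M) :
    energy D α₀ α₁ u (fun i ↦ u i.succ) = α₀ * inducedTV2 D M n u := by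
  simp only [energy, inducedTV2, dist_self, mul_zero, Finset.sum_const_zero, zero_add,
    Finset.mul_sum, Fin.succ_mk]

theorem energy_castSucc (hD : ∀ x u : M, D M (x, x) (u, u) = 0) (u : Fin (n + 1) → M) :
    energy D α₀ α₁ u (fun i ↦ u i.castSucc) = α₁ * tv u := by
  simp [energy, tv, Finset.mul_sum, Fin.castSucc_mk, hD]

/-- The objective can vanish only at `y_i = u_{i+1}`, so that the induced `TV²` vanishes too. -/
theorem inducedTV2_eq_zero_of_energy_eq_zero (hα₀ : 0 < α₀) (hα₁ : 0 < α₁) {u : Fin (n + 1) → M}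
    {y : Fin n → M} (h : energy D α₀ α₁ u y = 0) :
    inducedTV2 D M n u = 0 := by
  have hA : ∀ i ∈ Finset.univ, 0 ≤ α₁ * dist (u (Fin.succ i)) (y i) := fun _ _ ↦
    mul_nonneg hα₁.le dist_nonneg
  have h1 := (add_eq_zero_iff_of_nonneg (Finset.sum_nonneg hA)
    (Finset.sum_nonneg fun _ _ ↦ mul_nonneg hα₀.le (NNReal.coe_nonneg _))).1 h
  have hy : y = fun i ↦ u i.succ := funext fun i ↦ by
    have := (Finset.sum_eq_zero_iff_of_nonneg hA).1 h1.1 i (Finset.mem_univ i)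
    exact (dist_eq_zero.1 ((mul_eq_zero.1 this).resolve_left hα₁.ne')).symm
  rw [hy, energy_succ] at h
  exact (mul_eq_zero.1 h).resolve_left hα₀.ne'

theorem inducedTV2_eq_zero_iff {u : Fin (n + 1) → M} :
    inducedTV2 D M n u = 0 ↔ ∀ (j : ℕ) (h : j + 2 < n + 1),
      D M (u ⟨j + 1, by omega⟩, u ⟨j + 2, h⟩) (u ⟨j, by omega⟩, u ⟨j + 1, by omega⟩) = 0 := by
  rw [inducedTV2, Finset.sum_eq_zero_iff_of_nonneg fun _ _ ↦ NNReal.coe_nonneg _]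
  refine ⟨fun h j hj ↦ ?_, fun h i _ ↦ ?_⟩
  · exact_mod_cast h ⟨j, by omega⟩ (Finset.mem_univ _)
  · exact_mod_cast h i (by omega)

end Energy

/-! ### Vector-valued signals -/

section VectorSpace

variable {D : DistanceTypeFunction} {α₀ α₁ : ℝ} {K n : ℕ}

theorem oneNorm_nonneg {k : ℕ} (w : Fin k → EuclideanSpace ℝ (Fin K)) : 0 ≤ oneNorm w :=
  Finset.sum_nonneg fun _ _ ↦ norm_nonneg _

/-- Here `‖w‖` is the sup norm on the product, whose growth yields coercivity. -/
theorem norm_le_oneNorm {k : ℕ} (w : Fin k → EuclideanSpace ℝ (Fin K)) : ‖w‖ ≤ oneNorm w :=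
  (pi_norm_le_iff_of_nonneg (oneNorm_nonneg w)).2 fun i ↦
    Finset.single_le_sum (f := fun i ↦ ‖w i‖) (fun _ _ ↦ norm_nonneg _) (Finset.mem_univ i)

/-- The first term alone is at least `α₁ * (‖w‖ - ‖forwardDiff u‖)`, so the continuous objective
tends to infinity at infinity. -/
theorem exists_forall_tgvEnergy_le (hα₀ : 0 < α₀) (hα₁ : 0 < α₁)
    (u : Fin (n + 1) → EuclideanSpace ℝ (Fin K)) :
    ∃ w, ∀ w', tgvEnergy α₀ α₁ u w ≤ tgvEnergy α₀ α₁ u w' := by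
  have hcont : Continuous (tgvEnergy α₀ α₁ u) := by
    unfold tgvEnergy oneNorm backwardDiff
    simp only [Pi.sub_apply]
    fun_prop
  refine hcont.exists_forall_le ?_
  have ht : Tendsto (fun w : Fin n → EuclideanSpace ℝ (Fin K) ↦
      α₁ * (‖w‖ - ‖forwardDiff u‖)) (cocompact _) atTop :=
    (tendsto_atTop_add_const_right _ _ tendsto_norm_cocompact_atTop).const_mul_atTop hα₁
  refine tendsto_atTop_mono (fun w ↦ ?_) ht
  have h1 : ‖w‖ - ‖forwardDiff u‖ ≤ oneNorm (forwardDiff u - w) := by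
    refine le_trans ?_ (norm_le_oneNorm _)
    rw [norm_sub_rev]
    exact norm_sub_norm_le _ _
  exact (mul_le_mul_of_nonneg_left h1 hα₁.le).trans
    (le_add_of_nonneg_right (mul_nonneg hα₀.le (oneNorm_nonneg _)))

theorem energy_eq_tgvEnergy
    (hD : ∀ x y u v : EuclideanSpace ℝ (Fin K),
      (D (euclidean K) (x, y) (u, v) : ℝ) = ‖(y - x) - (v - u)‖)
    (u : Fin (n + 1) → EuclideanSpace ℝ (Fin K))
    (y : Fin n → EuclideanSpace ℝ (Fin K)) :
    energy D α₀ α₁ (M := euclidean K) u y =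
      tgvEnergy α₀ α₁ u (fun i ↦ y i - u i.castSucc) := by
  unfold energy tgvEnergy oneNorm
  rw [Finset.mul_sum, Finset.mul_sum]
  congr 1
  · refine Finset.sum_congr rfl fun i _ ↦ ?_
    congr 1
    refine (dist_eq_norm (u i.succ) (y i)).trans ?_
    simp [forwardDiff]
  · refine Finset.sum_congr rfl fun i _ ↦ ?_
    rw [hD]
    rfl

theorem inducedTV2_eq_vectorTV2
    (hD : ∀ x y u v : EuclideanSpace ℝ (Fin K),
      (D (euclidean K) (x, y) (u, v) : ℝ) = ‖(y - x) - (v - u)‖)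
    (u : Fin (n + 1) → EuclideanSpace ℝ (Fin K)) :
    inducedTV2 D (euclidean K) n u = vectorTV2 u := by
  refine Finset.sum_congr rfl fun i _ ↦ ?_
  rw [hD]
  congr 1
  module

end VectorSpace

end MTGV

open MTGV in
theorem proposition2p8 (D : MTGV.DistanceTypeFunction) (α₀ α₁ : ℝ) (hα₀ : 0 < α₀) (hα₁ : 0 < α₁)
    (hD_zero : ∀ (M : MTGV.RiemannianMfd) (x u : M), D M (x, x) (u, u) = 0)
    (hD_vec : ∀ (K : ℕ) (x y u v : EuclideanSpace ℝ (Fin K)),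
      (D (MTGV.euclidean K) (x, y) (u, v) : ℝ) = ‖(y - x) - (v - u)‖) :
    MTGV.PropertyMP1 D α₀ α₁ ∧ MTGV.PropertyMP2 D α₀ α₁ ∧ MTGV.PropertyMP3 D α₀ α₁ ∧
    -- locally geodesic signals lie in the zero set
    (∀ M : MTGV.RiemannianMfd,
      (∀ v : Fin 3 → M, MTGV.IsGeodesicSignal M.dim (n := 2) v →
        D M (v 1, v 2) (v 0, v 1) = 0) →
      ∀ (n : ℕ) (u : Fin (n + 1) → M), MTGV.IsLocallyGeodesicSignal M.dim u →
        (∃ y : Fin n → M, MTGV.MinAttainedAt D α₀ α₁ u y) ∧ MTGV.mtgv D α₀ α₁ u = 0) ∧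
    -- the converse, under uniqueness of geodesics between neighbors
    (∀ M : MTGV.RiemannianMfd,
      (∀ v : Fin 3 → M, MTGV.UniqueNeighborGeodesics M.dim (n := 2) v →
        D M (v 1, v 2) (v 0, v 1) = 0 → MTGV.IsGeodesicSignal M.dim (n := 2) v) →
      ∀ (n : ℕ) (u : Fin (n + 1) → M), MTGV.UniqueNeighborGeodesics M.dim u →
        (∃ y : Fin n → M, MTGV.MinAttainedAt D α₀ α₁ u y) → MTGV.mtgv D α₀ α₁ u = 0 →
        MTGV.IsGeodesicSignal M.dim u) := by
  refine ⟨fun K n u ↦ ?_, fun M n u h ↦ ?_, ⟨fun K n u ↦ ?_, fun M n u h ↦ ?_⟩,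
    fun M hD n u hu ↦ ?_, fun M hD n u hu ⟨y, hy⟩ h0 ↦ ?_⟩
  · obtain ⟨w, hw⟩ := exists_forall_tgvEnergy_le hα₀ hα₁ u
    have hE := fun y ↦ energy_eq_tgvEnergy (α₀ := α₀) (α₁ := α₁) (hD_vec K) u y
    have hmin : MinAttainedAt D α₀ α₁ (M := euclidean K) u (fun i ↦ w i + u i.castSucc) := by
      intro y
      rw [hE, hE]
      simpa using hw _
    refine ⟨⟨_, hmin⟩, ⟨w, hw⟩, ?_⟩
    rw [hmin.mtgv_eq, hE]
    simp only [add_sub_cancel_right]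
    exact le_antisymm (le_ciInf hw) (ciInf_le ⟨_, by rintro _ ⟨w', rfl⟩; exact hw w'⟩ w)
  · rw [h.mtgv_eq, energy_castSucc (hD_zero M)]
  · exact inducedTV2_eq_vectorTV2 (hD_vec K) u
  · rw [h.mtgv_eq, energy_succ]
  -- At `y_i = u_{i+1}` the objective is zero, its least conceivable value, so the minimum is
  -- attained there.
  · have hTV : inducedTV2 D M n u = 0 := inducedTV2_eq_zero_iff.2 fun j hj ↦ hD _ (hu j hj)
    have hE : energy D α₀ α₁ u (fun i ↦ u i.succ) = 0 := by rw [energy_succ, hTV, mul_zero]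
    have hmin : MinAttainedAt D α₀ α₁ u (fun i ↦ u i.succ) := fun y' ↦
      hE.trans_le (energy_nonneg hα₀.le hα₁.le u y')
    exact ⟨⟨_, hmin⟩, hmin.mtgv_eq.trans hE⟩
  · have hTV := inducedTV2_eq_zero_of_energy_eq_zero hα₀ hα₁ (hy.mtgv_eq.symm.trans h0)
    refine IsLocallyGeodesicSignal.isGeodesicSignal (fun j hj ↦ hD _ ?_
      (inducedTV2_eq_zero_iff.1 hTV j hj)) hu
    -- As an index shift by `j`, the triple has the same index differences as `u`, so it inherits
    -- uniqueness between neighbors.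
    have hv : ![u ⟨j, by omega⟩, u ⟨j + 1, by omega⟩, u ⟨j + 2, hj⟩] =
        fun i : Fin 3 ↦ u ⟨j + i, by omega⟩ := by
      funext i
      fin_cases i <;> rfl
    rw [hv]
    exact fun i i' hii ↦ hu _ _ (by push_cast; simpa using hii)
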